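/- Let $K\subset\mathbb{E}^3$ be a convex body (a compact convex set with non-empty interior), and let $N,S\in\operatorname{bd}K$ with $N\neq S$. Suppose that $K$ has exactly one support plane $\Pi_S$ at $S$, and that the stereographic projection $\Psi$ from $N$ onto $\Pi_S$ is well defined, i.e. for every $x\in\operatorname{bd}K\setminus\{N\}$ the line $L(N,x)$ meets $\Pi_S$ in exactly one point. Then the same holds for every $x\in K\setminus\{N\}$, and we write $\Psi(x)$ for the point of $L(N,x)\cap\Pi_S$. For a plane $\Gamma$ with $N\notin\Gamma$ put $K_\Gamma:=\Gamma\cap K$, and let $C_N(K_\Gamma)$ be the boundary of the cone $\{N+\lambda(y-N): y\in K_\Gamma,\ \lambda\ge 0\}$. Suppose that for every plane $\Gamma$ such that $\Gamma\cap\operatorname{int}K\neq\emptyset$, $N\notin\Gamma$ and $\Gamma$ is not parallel to $\Pi_S$, there exist a rotation $R^\Gamma$ by the angle $\pi$ around some line $L_\Gamma$ and a homothetic copy $K'_\Gamma=N+k(K_\Gamma-N)$, $k\ne 0$, of $K_\Gamma$ with centre of homothety $N$, such that $$R^\Gamma(C_N(K_\Gamma))=C_N(K_\Gamma)\qquad\text{and}\qquad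 \Psi(K_\Gamma)=R^\Gamma(K'_\Gamma).$$ Then $K$ is a ball, i.e. its boundary is a sphere. -/

import Mathlib

/-- Three-dimensional Euclidean space. -/
abbrev E3 : Type := EuclideanSpace ℝ (Fin 3)

/-- A convex body: a compact convex set with non-empty interior. -/
structure IsConvexBody (K : Set E3) : Prop where
  convex : Convex ℝ K
  isCompact : IsCompact K
  interior_nonempty : (interior K).Nonempty

/-- An affine plane of `E3` (the empty affine subspace has a zero-dimensional direction, so it is
excluded). -/
def IsPlane (Γ : AffineSubspace ℝ E3) : Prop :=
  Module.finrank ℝ Γ.direction = 2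

/-- An affine line of `E3`. -/
def IsLine (L : AffineSubspace ℝ E3) : Prop :=
  Module.finrank ℝ L.direction = 1

/-- `P` is a support plane of `K` at the point `x ∈ K`: the plane through `x` with some normal
`n ≠ 0`, such that `K` lies in one of the two closed half-spaces bounded by it. -/
def IsSupportPlane (K : Set E3) (x : E3) (P : AffineSubspace ℝ E3) : Prop :=
  x ∈ K ∧ ∃ n : E3, n ≠ 0 ∧ (∀ y : E3, y ∈ P ↔ inner ℝ n y = inner ℝ n x) ∧
    ∀ y ∈ K, inner ℝ n y ≤ inner ℝ n x

/-- The cone generated by `W` with apex `x`. -/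
def solidCone (x : E3) (W : Set E3) : Set E3 :=
  {p | ∃ y ∈ W, ∃ t : ℝ, 0 ≤ t ∧ p = x + t • (y - x)}

/-- The conical surface with apex `x` over `W`: the boundary of the solid cone. -/
def boundaryCone (x : E3) (W : Set E3) : Set E3 :=
  frontier (solidCone x W)

/-- The rule `x ↦ L(N, x) ∩ P` is a well-defined map from the boundary of `K` without `N` to `P`:
each line through `N` and another boundary point of `K` meets `P` in exactly one point. -/
def StereographicWellDefined (K : Set E3) (N : E3) (P : AffineSubspace ℝ E3) : Prop :=
  ∀ x ∈ frontier K, x ≠ N → ∃! y : E3, y ∈ affineSpan ℝ {N, x} ∧ y ∈ P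

/-- The image of a set `A` under the stereographic projection from `N` to `P`, that is, the set of
the points of the form `L(N, x) ∩ P`, where `x ∈ A`, `x ≠ N`. -/
def stereographicImage (N : E3) (P : AffineSubspace ℝ E3) (A : Set E3) : Set E3 :=
  {y | ∃ x ∈ A, x ≠ N ∧ y ∈ affineSpan ℝ {N, x} ∧ y ∈ P}

/-- `R` is the rotation by the angle `π` about some line `L`. In dimension three this is the map
that fixes `L` pointwise and is minus the identity on the directions orthogonal to `L`. -/
def IsHalfTurn (R : E3 ≃ᵃⁱ[ℝ] E3) : Prop :=
  ∃ (L : AffineSubspace ℝ E3) (_ : Nonempty L), IsLine L ∧ R = EuclideanGeometry.reflection L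

open scoped RealInnerProductSpace

/-! Take `N` as origin and let `e` be the unit normal of `P` pointing from `N` to `S`.
Well-definedness of the projection makes `⟪e, x⟫` positive on all of `K` but the origin. For a
section `⟪a, y⟫ = 1`, the half turn `R` fixes the apex because the cone is pointed. Since `Ψ(K_Γ)`
lies in `P`, `⟪e, R y⟫` is constant on the section, so `R e` is a multiple of `a`. The image
condition also makes `R` send rays of the cone to rays of the cone. This is
`HasAntiparallelSections`.

The quantity to control is `‖y‖ ^ 2 / ⟪e, y⟫`, the diameter of the sphere through `y` that touches
`eᗮ` at the origin. If a chord crosses the interior, spans a plane containing `e` and is not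
orthogonal to `e`, choose `a` in that plane. Then `R` acts on it and swaps the two boundary rays,
and comparing lengths gives the same quantity at both ends (`HasAntiparallelSections.chord`).

Letting sections tend to one orthogonal to `e` shows that the axis `ℝ e` enters the interior, ending
at some `τ • e`. Chords to `τ • e`, or across the axis, then transport the value `τ` to every
boundary point (`IsAxialBody.norm_sq_eq`), so the boundary lies on a sphere. -/

theorem IsPreconnected.exists_mem_frontier {X : Type*} [TopologicalSpace X] {s t : Set X}
    (hs : IsPreconnected s) (h₁ : (s ∩ t).Nonempty) (h₂ : (s ∩ tᶜ).Nonempty) :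
    (s ∩ frontier t).Nonempty := by
  by_contra hne
  have hf : ∀ x ∈ s, x ∉ frontier t := fun x hx hxf => hne ⟨x, hx, hxf⟩
  have hcov : s ⊆ interior t ∪ (closure t)ᶜ := by
    intro x hx
    by_cases hi : x ∈ interior t
    · exact Or.inl hi
    · exact Or.inr fun hc => hf x hx ⟨hc, hi⟩
  obtain ⟨x, hx, hxt⟩ := h₁
  obtain ⟨y, hy, hyt⟩ := h₂
  have hxi : x ∈ interior t := (hcov hx).resolve_right fun h => h (subset_closure hxt)
  have hyc : y ∈ (closure t)ᶜ := (hcov hy).resolve_left fun h => hyt (interior_subset h)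
  obtain ⟨z, -, hz1, hz2⟩ :=
    hs _ _ isOpen_interior isClosed_closure.isOpen_compl hcov ⟨x, hx, hxi⟩ ⟨y, hy, hyc⟩
  exact hz2 (subset_closure (interior_subset hz1))

/-! ### Rays, chords and the boundary of a body -/

section RadialBoundary

variable {V : Type*} [NormedAddCommGroup V] [NormedSpace ℝ V]

theorem exists_nonneg_add_smul_mem_frontier {K : Set V} (hK : Bornology.IsBounded K) {m d : V}
    (hm : m ∈ K) (hd : d ≠ 0) : ∃ r : ℝ, 0 ≤ r ∧ m + r • d ∈ frontier K := by
  have hpre : IsPreconnected ((fun r : ℝ => m + r • d) '' Set.Ici 0) :=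
    isPreconnected_Ici.image _ (by fun_prop)
  obtain ⟨C, hC⟩ := hK.exists_norm_le
  have hd' : 0 < ‖d‖ := norm_pos_iff.2 hd
  have hC0 : 0 ≤ C := (norm_nonneg _).trans (hC m hm)
  have hout : m + ((2 * C + 1) / ‖d‖) • d ∉ K := by
    intro h
    have h1 := hC _ h
    have h2 : ‖((2 * C + 1) / ‖d‖) • d‖ = 2 * C + 1 := by
      rw [norm_smul, Real.norm_of_nonneg (by positivity)]
      field_simp
    have h3 := norm_sub_le (m + ((2 * C + 1) / ‖d‖) • d) m
    rw [add_sub_cancel_left, h2] at h3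
    linarith [hC m hm]
  obtain ⟨x, ⟨r, hr, rfl⟩, hx⟩ := hpre.exists_mem_frontier (t := K)
    ⟨m, ⟨0, by simp, by simp⟩, hm⟩
    ⟨_, ⟨(2 * C + 1) / ‖d‖, by simp only [Set.mem_Ici]; positivity, rfl⟩, hout⟩
  exact ⟨r, hr, hx⟩

theorem exists_pos_add_smul_mem_frontier {K : Set V} (hK : Bornology.IsBounded K) {m d : V}
    (hm : m ∈ interior K) (hd : d ≠ 0) : ∃ r : ℝ, 0 < r ∧ m + r • d ∈ frontier K := by
  obtain ⟨r, hr, h⟩ := exists_nonneg_add_smul_mem_frontier hK (interior_subset hm) hd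
  refine ⟨r, hr.lt_of_ne ?_, h⟩
  rintro rfl
  simp only [zero_smul, add_zero] at h
  exact h.2 hm

/-- A point of `K` outside the ball could be pushed away from `c` to a frontier point still farther
out; a point of the open ball missing from `K` would force a frontier point inside the ball. -/
theorem eq_closedBall_of_frontier_subset_sphere {K : Set V} (hK : IsCompact K) {c : V}
    (hc : c ∈ interior K) {r : ℝ} (hr : 0 < r) (h : frontier K ⊆ Metric.sphere c r) :
    K = Metric.closedBall c r := by
  apply Set.Subset.antisymm
  · intro x hx
    by_contra hxb
    rw [Metric.mem_closedBall, not_le, dist_eq_norm] at hxb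
    obtain ⟨s, hs, hf⟩ := exists_nonneg_add_smul_mem_frontier (d := x - c) hK.isBounded hx
      (norm_pos_iff.1 (hr.trans hxb))
    have h1 := h hf
    rw [mem_sphere_iff_norm, show x + s • (x - c) - c = (1 + s) • (x - c) by module,
      norm_smul, Real.norm_of_nonneg (by positivity)] at h1
    nlinarith
  · rw [← closure_ball c hr.ne']
    refine closure_minimal ?_ hK.isClosed
    intro x hx
    by_contra hxK
    obtain ⟨y, hy, hyf⟩ := (convex_ball c r).isPreconnected.exists_mem_frontier (t := K)
      ⟨c, Metric.mem_ball_self hr, interior_subset hc⟩ ⟨x, hx, hxK⟩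
    exact absurd (h hyf) (ne_of_lt hy)

/-- A chord through an interior point leaves a convex set at its endpoints. -/
theorem Convex.le_one_of_mem_of_frontier {K : Set V} (hK : Convex ℝ K) {x y : V} {s μ : ℝ}
    (hy : y ∈ frontier K) (hs : s < 1)
    (hp : x + s • (y - x) ∈ interior K) (hq : x + μ • (y - x) ∈ K) : μ ≤ 1 := by
  by_contra! hμ
  refine hy.2 (hK.openSegment_interior_self_subset_interior hp hq
    ⟨(μ - 1) / (μ - s), (1 - s) / (μ - s), ?_, ?_, ?_, ?_⟩)
  · exact div_pos (by linarith) (by linarith)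
  · exact div_pos (by linarith) (by linarith)
  · have : μ - s ≠ 0 := by linarith
    field_simp; ring
  · have : μ - s ≠ 0 := by linarith
    match_scalars <;> field_simp <;> ring

end RadialBoundary

/-! ### Linear half turns and the chord identity -/

section HalfTurn

variable {V : Type*} [NormedAddCommGroup V] [InnerProductSpace ℝ V]

/-- The half turn about the line spanned by the unit vector `u`. -/
noncomputable def halfTurn (u : V) : V →ₗ[ℝ] V :=
  (2 : ℝ) • (innerₛₗ ℝ u).smulRight u - LinearMap.id

theorem halfTurn_apply (u x : V) : halfTurn u x = (2 * ⟪u, x⟫) • u - x := by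
  simp [halfTurn, smul_smul]

theorem inner_halfTurn_left (u x y : V) : ⟪halfTurn u x, y⟫ = ⟪x, halfTurn u y⟫ := by
  simp only [halfTurn_apply, inner_sub_left, inner_sub_right, inner_smul_left, inner_smul_right,
    real_inner_comm u x]
  simp; ring

theorem halfTurn_halfTurn {u : V} (hu : ‖u‖ = 1) (x : V) : halfTurn u (halfTurn u x) = x := by
  have h : ⟪u, u⟫ = 1 := by rw [real_inner_self_eq_norm_sq, hu]; norm_num
  simp only [halfTurn_apply, inner_sub_right, inner_smul_right, h]
  module

theorem norm_halfTurn {u : V} (hu : ‖u‖ = 1) (x : V) : ‖halfTurn u x‖ = ‖x‖ := by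
  have h : ‖halfTurn u x‖ ^ 2 = ‖x‖ ^ 2 := by
    rw [← real_inner_self_eq_norm_sq, inner_halfTurn_left, halfTurn_halfTurn hu,
      real_inner_self_eq_norm_sq]
  exact (pow_left_inj₀ (norm_nonneg _) (norm_nonneg _) two_ne_zero).1 h

/-- Rewrites the half turn through an unnormalised axis vector, which makes its dependence on the
axis visibly continuous. -/
theorem halfTurn_apply_of_smul_eq {u v : V} (hu : ‖u‖ = 1) {l : ℝ} (hv : l • u = v) (hv0 : v ≠ 0)
    (x : V) : halfTurn u x = (2 * ⟪v, x⟫ / ⟪v, v⟫) • v - x := by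
  have h : ⟪u, u⟫ = 1 := by rw [real_inner_self_eq_norm_sq, hu]; norm_num
  have hl : l ≠ 0 := by rintro rfl; simp at hv; exact hv0 hv.symm
  subst hv
  simp only [halfTurn_apply, real_inner_smul_left, real_inner_smul_right, h]
  congr 1
  rw [smul_smul]
  congr 1
  field_simp

/-- The cone with apex `0` over each section `{y ∈ K | ⟪a, y⟫ = 1}` through the interior of `K`
and transversal to `e` is mapped into itself by a half turn which takes the direction
of `e` to that of `a`. -/
def HasAntiparallelSections (K : Set V) (e : V) : Prop :=
  ∀ a p : V, p ∈ interior K → ⟪a, p⟫ = 1 → a ∉ Submodule.span ℝ {e} →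
    ∃ u : V, ‖u‖ = 1 ∧ ∃ c : ℝ, 0 < c ∧ halfTurn u e = c • a ∧
      ∀ y ∈ K, ⟪a, y⟫ = 1 → ∃ t : ℝ, 0 < t ∧ ∃ q ∈ K, ⟪a, q⟫ = 1 ∧ halfTurn u y = t • q

/-- A half turn negates vectors orthogonal to its axis, which would make `a` parallel to `e`. -/
theorem inner_ne_zero_of_halfTurn_eq {u e a : V} {c : ℝ} (hc : 0 < c)
    (h : halfTurn u e = c • a) (ha : a ∉ Submodule.span ℝ {e}) : ⟪u, e⟫ ≠ 0 := by
  intro h0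
  apply ha
  rw [Submodule.mem_span_singleton]
  refine ⟨-c⁻¹, ?_⟩
  rw [halfTurn_apply, h0] at h
  have : a = c⁻¹ • c • a := by rw [smul_smul, inv_mul_cancel₀ hc.ne', one_smul]
  rw [this, ← h]
  module

/-- The half turn preserves the plane of `y₁`, `y₂` and maps their angular sector to itself, so it
fixes or swaps the bounding rays. Fixing both would fix `e`, making `a` parallel to `e`; swapping
gives the identity. The condition `hne` keeps the cutting plane from being orthogonal to `e`. -/
theorem HasAntiparallelSections.chord {K : Set V} {e : V} (hsym : HasAntiparallelSections K e)
    (hK : Convex ℝ K) (hcl : IsClosed K) {y₁ y₂ : V} (h₁ : y₁ ∈ frontier K)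
    (h₂ : y₂ ∈ frontier K) {s : ℝ} (hs0 : 0 < s) (hs1 : s < 1)
    (hp : y₁ + s • (y₂ - y₁) ∈ interior K) {c₁ c₂ : ℝ} (he : e = c₁ • y₁ + c₂ • y₂)
    (he0 : e ≠ 0) (hy₁ : y₁ ∉ Submodule.span ℝ {e}) (hne : ⟪e, y₁⟫ ≠ ⟪e, y₂⟫) :
    ‖y₁‖ ^ 2 * ⟪e, y₂⟫ = ‖y₂‖ ^ 2 * ⟪e, y₁⟫ := by
  have hli : ∀ α β : ℝ, α • y₁ + β • y₂ = 0 → α = 0 ∧ β = 0 := by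
    have hy0 : y₁ ≠ 0 := by rintro rfl; simp at hy₁
    intro α β hab
    have hβ : β = 0 := by
      by_contra hβ
      have h2 : y₂ = (-(α / β)) • y₁ := by
        have : y₂ = β⁻¹ • (β • y₂) := by rw [smul_smul, inv_mul_cancel₀ hβ, one_smul]
        rw [this, eq_neg_of_add_eq_zero_right hab]
        match_scalars; field_simp
      have h3 : e = (c₁ + c₂ * (-(α / β))) • y₁ := by rw [he, h2]; module
      have h4 : c₁ + c₂ * (-(α / β)) ≠ 0 := by
        intro h; rw [h, zero_smul] at h3; exact he0 h3
      apply hy₁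
      rw [Submodule.mem_span_singleton]
      refine ⟨(c₁ + c₂ * (-(α / β)))⁻¹, ?_⟩
      rw [h3, smul_smul, inv_mul_cancel₀ h4, one_smul]
    subst hβ
    simp only [zero_smul, add_zero, smul_eq_zero, hy0, or_false] at hab
    exact ⟨hab, rfl⟩
  have hinj : ∀ α β γ δ : ℝ, α • y₁ + β • y₂ = γ • y₁ + δ • y₂ → α = γ ∧ β = δ := by
    intro α β γ δ h
    have := hli (α - γ) (β - δ) (by
      rw [sub_smul, sub_smul, ← sub_eq_zero.2 h]; abel)
    exact ⟨sub_eq_zero.1 this.1, sub_eq_zero.1 this.2⟩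
  -- the normal vector of the plane through `y₁`, `y₂` orthogonal to their span
  obtain ⟨a, α, β, ha, ha₁, ha₂⟩ : ∃ (a : V) (α β : ℝ), a = α • y₁ + β • y₂ ∧ ⟪a, y₁⟫ = 1 ∧
      ⟪a, y₂⟫ = 1 := by
    have hdet : ⟪y₁, y₁⟫ * ⟪y₂, y₂⟫ - ⟪y₁, y₂⟫ ^ 2 ≠ 0 := by
      intro h0
      have h1 : ⟪⟪y₂, y₂⟫ • y₁ + (-⟪y₁, y₂⟫) • y₂, ⟪y₂, y₂⟫ • y₁ + (-⟪y₁, y₂⟫) • y₂⟫ = 0 := by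
        simp only [inner_add_left, inner_add_right, real_inner_smul_left, real_inner_smul_right,
          real_inner_comm y₁ y₂]
        linear_combination ⟪y₂, y₂⟫ * h0
      have h2 := (hli _ _ (inner_self_eq_zero.1 h1)).1
      have h3 := hli 0 1 (by rw [inner_self_eq_zero.1 h2]; simp)
      exact one_ne_zero h3.2
    refine ⟨_, (⟪y₂, y₂⟫ - ⟪y₁, y₂⟫) / (⟪y₁, y₁⟫ * ⟪y₂, y₂⟫ - ⟪y₁, y₂⟫ ^ 2),
      (⟪y₁, y₁⟫ - ⟪y₁, y₂⟫) / (⟪y₁, y₁⟫ * ⟪y₂, y₂⟫ - ⟪y₁, y₂⟫ ^ 2), rfl, ?_, ?_⟩ <;>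
    · simp only [inner_add_left, real_inner_smul_left, real_inner_comm y₁ y₂]
      rw [div_mul_eq_mul_div, div_mul_eq_mul_div, ← add_div, div_eq_one_iff_eq hdet]
      ring
  have hae : a ∉ Submodule.span ℝ {e} := by
    rw [Submodule.mem_span_singleton]
    rintro ⟨l, rfl⟩
    rw [real_inner_smul_left] at ha₁ ha₂
    have hl : l ≠ 0 := by rintro rfl; simp at ha₁
    exact hne (mul_left_cancel₀ hl (ha₁.trans ha₂.symm))
  obtain ⟨u, hu, c, hc, hR, hcone⟩ := hsym a _ hp (by
    rw [inner_add_right, real_inner_smul_right, inner_sub_right, ha₁, ha₂]; ring) hae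
  have hue := inner_ne_zero_of_halfTurn_eq hc hR hae
  -- The axis bisects `e` and its image `c • a`; both lie in the span of `y₁`, `y₂`.
  obtain ⟨x₁, x₂, hux⟩ : ∃ x₁ x₂ : ℝ, u = x₁ • y₁ + x₂ • y₂ := by
    refine ⟨(c * α + c₁) / (2 * ⟪u, e⟫), (c * β + c₂) / (2 * ⟪u, e⟫), ?_⟩
    have h1 : (2 * ⟪u, e⟫) • u = c • a + e := by
      rw [← hR, halfTurn_apply]; abel
    have h2 : u = (2 * ⟪u, e⟫)⁻¹ • (2 * ⟪u, e⟫) • u := by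
      rw [smul_smul, inv_mul_cancel₀ (by simpa using hue), one_smul]
    rw [h1, ha] at h2
    generalize hw : (2 * ⟪u, e⟫) = w at *
    rw [h2, he]
    module
  -- The section meets the span of `y₁`, `y₂` only in the chord itself, so images of section points
  -- lying in that span have nonnegative coordinates.
  have key : ∀ y ∈ K, ⟪a, y⟫ = 1 → ∀ γ δ : ℝ, halfTurn u y = γ • y₁ + δ • y₂ →
      0 ≤ γ ∧ 0 ≤ δ := by
    intro y hy hay γ δ hyγ
    obtain ⟨t, ht, q, hq, haq, hyq⟩ := hcone y hy hay
    have hq' : q = (γ / t) • y₁ + (δ / t) • y₂ := by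
      have : q = t⁻¹ • t • q := by rw [smul_smul, inv_mul_cancel₀ ht.ne', one_smul]
      rw [this, ← hyq, hyγ]; module
    have hsum : γ / t + δ / t = 1 := by
      rw [hq', inner_add_right, real_inner_smul_right, real_inner_smul_right, ha₁, ha₂] at haq
      linarith
    have e1 : δ / t ≤ 1 := hK.le_one_of_mem_of_frontier h₂ hs1 hp (by
      have : γ / t = 1 - δ / t := by linarith
      rw [this] at hq'
      convert hq using 1; rw [hq']; module)
    have e2 : γ / t ≤ 1 := hK.le_one_of_mem_of_frontier (x := y₂) (y := y₁) (s := 1 - s) h₁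
      (by linarith) (by convert hp using 1; module) (by
      have : δ / t = 1 - γ / t := by linarith
      rw [this] at hq'
      convert hq using 1; rw [hq']; module)
    have e3 : 0 ≤ δ / t := by linarith
    have e4 : 0 ≤ γ / t := by linarith
    constructor
    · have := mul_nonneg e4 ht.le
      rwa [div_mul_cancel₀ _ ht.ne'] at this
    · have := mul_nonneg e3 ht.le
      rwa [div_mul_cancel₀ _ ht.ne'] at this
  obtain ⟨A, B, hAB⟩ : ∃ A B : ℝ, halfTurn u y₁ = A • y₁ + B • y₂ :=
    ⟨2 * ⟪u, y₁⟫ * x₁ - 1, 2 * ⟪u, y₁⟫ * x₂, by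
      rw [halfTurn_apply]; generalize ⟪u, y₁⟫ = w; rw [hux]; module⟩
  obtain ⟨C, D, hCD⟩ : ∃ C D : ℝ, halfTurn u y₂ = C • y₁ + D • y₂ :=
    ⟨2 * ⟪u, y₂⟫ * x₁, 2 * ⟪u, y₂⟫ * x₂ - 1, by
      rw [halfTurn_apply]; generalize ⟪u, y₂⟫ = w; rw [hux]; module⟩
  obtain ⟨hA, hB⟩ := key y₁ (hcl.frontier_subset h₁) ha₁ _ _ hAB
  obtain ⟨hC, hD⟩ := key y₂ (hcl.frontier_subset h₂) ha₂ _ _ hCD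
  have r1 := halfTurn_halfTurn hu y₁
  have r2 := halfTurn_halfTurn hu y₂
  rw [hAB, map_add, map_smul, map_smul, hAB, hCD] at r1
  rw [hCD, map_add, map_smul, map_smul, hAB, hCD] at r2
  obtain ⟨m1, m2⟩ := hinj (A * A + B * C) (A * B + B * D) 1 0 (by
    rw [one_smul, zero_smul, add_zero]; refine Eq.trans ?_ r1; module)
  obtain ⟨m3, m4⟩ := hinj (C * A + D * C) (C * B + D * D) 0 1 (by
    rw [one_smul, zero_smul, zero_add]; refine Eq.trans ?_ r2; module)
  -- The matrix is a nonnegative involution: zero trace means the rays are swapped, positive trace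
  -- kills the off-diagonal entries.
  rcases (add_nonneg hA hD).eq_or_lt with h0 | h0
  · have hA0 : A = 0 := by linarith
    have hD0 : D = 0 := by linarith
    subst hA0 hD0
    rw [zero_smul, zero_add] at hAB
    rw [zero_smul, add_zero] at hCD
    have n1 : ‖y₁‖ ^ 2 = B ^ 2 * ‖y₂‖ ^ 2 := by
      rw [← norm_halfTurn hu y₁, hAB, norm_smul, mul_pow, Real.norm_eq_abs, sq_abs]
    have z1 : B * ⟪e, y₂⟫ = c := by
      have := inner_halfTurn_left u e y₁
      rw [hR, hAB, real_inner_smul_left, real_inner_smul_right, ha₁] at this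
      linarith
    have z2 : C * ⟪e, y₁⟫ = c := by
      have := inner_halfTurn_left u e y₂
      rw [hR, hCD, real_inner_smul_left, real_inner_smul_right, ha₂] at this
      linarith
    rw [n1]
    linear_combination B * ‖y₂‖ ^ 2 * z1 - B * ‖y₂‖ ^ 2 * z2 + ‖y₂‖ ^ 2 * ⟪e, y₁⟫ * m1
  · exfalso
    have hB0 : B = 0 := by
      have : B * (A + D) = 0 := by linarith
      exact (mul_eq_zero.1 this).resolve_right h0.ne'
    have hC0 : C = 0 := by
      have : C * (A + D) = 0 := by linarith
      exact (mul_eq_zero.1 this).resolve_right h0.ne'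
    subst hB0 hC0
    have hA1 : A = 1 := by nlinarith
    have hD1 : D = 1 := by nlinarith
    subst hA1 hD1
    have hee : halfTurn u e = e := by
      rw [he, map_add, map_smul, map_smul, hAB, hCD]; simp
    apply hae
    rw [Submodule.mem_span_singleton]
    refine ⟨c⁻¹, ?_⟩
    rw [← hee, hR, smul_smul, inv_mul_cancel₀ hc.ne', one_smul]

end HalfTurn

/-! ### The axis through the interior -/

section AntiparallelSections

variable {V : Type*} [NormedAddCommGroup V] [InnerProductSpace ℝ V]

/-- Isometry forces `c = ‖a‖⁻¹`, the axis is along `e + c • a`, and pairing with `e` gives the scale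
`t`. The resulting point of `K` is thus explicit in `a`, ready for a limit. -/
theorem HasAntiparallelSections.exists_smul_mem {K : Set V} {e : V}
    (hsym : HasAntiparallelSections K e) (he : ‖e‖ = 1) {y a : V} (hy : y ∈ interior K)
    (hpos : 0 < ⟪e, y⟫) (hay : ⟪a, y⟫ = 1) (hae : a ∉ Submodule.span ℝ {e}) :
    (‖a‖⁻¹ / ⟪e, y⟫) • ((2 * ⟪e + ‖a‖⁻¹ • a, y⟫ / ⟪e + ‖a‖⁻¹ • a, e + ‖a‖⁻¹ • a⟫) •
      (e + ‖a‖⁻¹ • a) - y) ∈ K := by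
  obtain ⟨u, hu, c, hc, hR, hcone⟩ := hsym a y hy hay hae
  obtain ⟨t, ht, q, hq, haq, hyq⟩ := hcone y (interior_subset hy) hay
  have ha0 : a ≠ 0 := by rintro rfl; simp at hay
  have hca : c = ‖a‖⁻¹ := by
    have h := norm_halfTurn hu e
    rw [hR, he, norm_smul, Real.norm_of_nonneg hc.le] at h
    exact eq_inv_of_mul_eq_one_left h
  rw [← hca]
  have hue := inner_ne_zero_of_halfTurn_eq hc hR hae
  have hv : (2 * ⟪u, e⟫) • u = e + c • a := by rw [← hR, halfTurn_apply]; abel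
  have hv0 : e + c • a ≠ 0 := by
    rw [← hv]
    refine smul_ne_zero (by simpa using hue) ?_
    rintro rfl; simp at hu
  rw [← halfTurn_apply_of_smul_eq hu hv hv0, hyq, smul_smul]
  have htc : t * c = ⟪e, y⟫ := by
    have h := inner_halfTurn_left u e (halfTurn u y)
    rw [halfTurn_halfTurn hu, hR, hyq, real_inner_smul_left, real_inner_smul_right, haq] at h
    linarith
  have : c / ⟪e, y⟫ * t = 1 := by
    rw [div_mul_eq_mul_div, mul_comm, htc, div_self hpos.ne']
  rwa [this, one_smul]

/-- Tilted planes converging to the one orthogonal to `e` show that `K` is invariant under the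
half turn about the line spanned by `e`. -/
theorem HasAntiparallelSections.halfTurn_mem {K : Set V} {e : V}
    (hsym : HasAntiparallelSections K e) (hcl : IsClosed K) (he : ‖e‖ = 1) {y w : V}
    (hy : y ∈ interior K) (hpos : 0 < ⟪e, y⟫) (hw : w ∉ Submodule.span ℝ {e}) :
    halfTurn e y ∈ K := by
  -- The factor keeps the tilted plane passing through `y`; at `δ = 0` it is orthogonal to `e`,
  -- hence the punctured limit below.
  let a : ℝ → V := fun δ => (⟪e, y⟫ + δ * ⟪w, y⟫)⁻¹ • (e + δ • w)
  let F : V → V := fun a => (‖a‖⁻¹ / ⟪e, y⟫) • ((2 * ⟪e + ‖a‖⁻¹ • a, y⟫ /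
    ⟪e + ‖a‖⁻¹ • a, e + ‖a‖⁻¹ • a⟫) • (e + ‖a‖⁻¹ • a) - y)
  have hee : ⟪e, e⟫ = 1 := by rw [real_inner_self_eq_norm_sq, he]; norm_num
  have he0 : e ≠ 0 := by rintro rfl; simp at he
  have hden : Filter.Tendsto (fun δ : ℝ => ⟪e, y⟫ + δ * ⟪w, y⟫) (nhds 0) (nhds ⟪e, y⟫) := by
    have : Continuous fun δ : ℝ => ⟪e, y⟫ + δ * ⟪w, y⟫ := by fun_prop
    simpa using this.tendsto 0
  have ha : Filter.Tendsto a (nhds 0) (nhds (⟪e, y⟫⁻¹ • e)) := by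
    refine (hden.inv₀ hpos.ne').smul ?_
    have : Continuous fun δ : ℝ => e + δ • w := by fun_prop
    simpa using this.tendsto 0
  have hn : ‖⟪e, y⟫⁻¹ • e‖⁻¹ • (⟪e, y⟫⁻¹ • e) = e := by
    rw [norm_smul, he, Real.norm_of_nonneg (by positivity), mul_one, inv_inv, smul_smul,
      mul_inv_cancel₀ hpos.ne', one_smul]
  have ha0 : ⟪e, y⟫⁻¹ • e ≠ 0 := smul_ne_zero (by positivity) he0
  have hF : ContinuousAt F (⟪e, y⟫⁻¹ • e) := by
    have h1 : ContinuousAt (fun a : V => ‖a‖⁻¹) (⟪e, y⟫⁻¹ • e) :=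
      continuousAt_id.norm.inv₀ (norm_ne_zero_iff.2 ha0)
    have h2 : ContinuousAt (fun a : V => e + ‖a‖⁻¹ • a) (⟪e, y⟫⁻¹ • e) :=
      continuousAt_const.add (h1.smul continuousAt_id)
    refine (h1.div_const _).smul ((ContinuousAt.smul (ContinuousAt.div
      (continuousAt_const.mul (h2.inner continuousAt_const)) (h2.inner h2) ?_) h2).sub
      continuousAt_const)
    rw [hn, inner_self_ne_zero, ← two_smul ℝ e]
    exact smul_ne_zero two_ne_zero he0
  have hFe : F (⟪e, y⟫⁻¹ • e) = halfTurn e y := by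
    simp only [F, hn]
    rw [norm_smul, he, Real.norm_of_nonneg (by positivity), mul_one, inv_inv,
      div_self hpos.ne', one_smul, halfTurn_apply]
    simp only [← two_smul ℝ e, real_inner_smul_left, real_inner_smul_right, hee, smul_smul]
    congr 2
    ring
  have hlim : Filter.Tendsto (F ∘ a) (nhdsWithin 0 {0}ᶜ) (nhds (halfTurn e y)) := by
    rw [← hFe]
    exact (hF.tendsto.comp ha).mono_left nhdsWithin_le_nhds
  refine hcl.mem_of_tendsto hlim ?_
  filter_upwards [self_mem_nhdsWithin,
    nhdsWithin_le_nhds (hden.eventually (lt_mem_nhds hpos))] with δ hδ hδpos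
  refine hsym.exists_smul_mem he hy hpos ?_ ?_
  · simp only [a, real_inner_smul_left, inner_add_left]
    exact inv_mul_cancel₀ hδpos.ne'
  · intro hmem
    apply hw
    rw [Submodule.mem_span_singleton] at hmem ⊢
    obtain ⟨l, hl⟩ := hmem
    refine ⟨δ⁻¹ * ((⟪e, y⟫ + δ * ⟪w, y⟫) * l - 1), ?_⟩
    have h1 : ((⟪e, y⟫ + δ * ⟪w, y⟫) * l) • e = e + δ • w := by
      rw [mul_smul, hl, smul_smul, mul_inv_cancel₀ hδpos.ne', one_smul]
    rw [mul_smul, sub_smul, h1, one_smul, add_sub_cancel_left, smul_smul, inv_mul_cancel₀ hδ,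
      one_smul]

theorem HasAntiparallelSections.exists_smul_mem_interior {K : Set V} {e : V}
    (hsym : HasAntiparallelSections K e) (hK : Convex ℝ K) (hcl : IsClosed K) (he : ‖e‖ = 1)
    {y w : V} (hy : y ∈ interior K) (hpos : 0 < ⟪e, y⟫) (hw : w ∉ Submodule.span ℝ {e}) :
    ∃ t : ℝ, 0 < t ∧ t • e ∈ interior K := by
  refine ⟨⟪e, y⟫, hpos, hK.openSegment_interior_self_subset_interior hy
    (hsym.halfTurn_mem hcl he hy hpos hw) ⟨1 / 2, 1 / 2, by norm_num, by norm_num, by norm_num, ?_⟩⟩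
  rw [halfTurn_apply]
  module

/-- A convex body `K` touching the plane `eᗮ` only at `0 ∈ frontier K` and meeting the half-line
spanned by `e` exactly in the segment from `0` to `τ • e`. -/
structure IsAxialBody (K : Set V) (e : V) (τ : ℝ) : Prop where
  convex : Convex ℝ K
  isCompact : IsCompact K
  norm_eq_one : ‖e‖ = 1
  pos : 0 < τ
  inner_pos : ∀ x ∈ K, x ≠ 0 → 0 < ⟪e, x⟫
  smul_mem_frontier : τ • e ∈ frontier K
  smul_mem_interior : ∀ s : ℝ, 0 < s → s < τ → s • e ∈ interior K

theorem exists_isAxialBody {K : Set V} {e : V} (hK : Convex ℝ K) (hc : IsCompact K)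
    (he : ‖e‖ = 1) (h0 : 0 ∈ frontier K) (hpos : ∀ x ∈ K, x ≠ 0 → 0 < ⟪e, x⟫) {t : ℝ}
    (ht : 0 < t) (hte : t • e ∈ interior K) : ∃ τ, IsAxialBody K e τ := by
  have he0 : e ≠ 0 := by rintro rfl; simp at he
  obtain ⟨r, hr, hrf⟩ := exists_pos_add_smul_mem_frontier hc.isBounded hte he0
  rw [← add_smul] at hrf
  refine ⟨t + r, hK, hc, he, by positivity, hpos, hrf, fun s hs hs' => ?_⟩
  rcases lt_trichotomy s t with h | rfl | h
  · exact hK.openSegment_interior_self_subset_interior hte (hc.isClosed.frontier_subset h0)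
      ⟨s / t, 1 - s / t, by positivity, by rw [sub_pos, div_lt_one ht]; exact h, by ring, by
        rw [smul_zero, add_zero, smul_smul, div_mul_cancel₀ _ ht.ne']⟩
  · exact hte
  · refine hK.openSegment_interior_self_subset_interior hte (hc.isClosed.frontier_subset hrf)
      ⟨(t + r - s) / r, (s - t) / r, div_pos (by linarith) hr, div_pos (by linarith) hr, ?_, ?_⟩
    · field_simp; ring
    · rw [smul_smul, smul_smul, ← add_smul]
      congr 1
      field_simp; ring

/-! ### Every boundary point lies on one sphere -/

namespace IsAxialBody

variable {K : Set V} {e : V} {τ : ℝ}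

theorem inner_self (h : IsAxialBody K e τ) : ⟪e, e⟫ = 1 := by
  rw [real_inner_self_eq_norm_sq, h.norm_eq_one]; norm_num

theorem ne_zero (h : IsAxialBody K e τ) : e ≠ 0 := by
  rintro rfl; simpa using h.norm_eq_one

/-- Follow the line from `y` through the low axis point `ε • e` until it leaves `K`; the exit point
lies lower still. -/
theorem exists_opposite (h : IsAxialBody K e τ) {y : V} (hy : y ∉ Submodule.span ℝ {e}) {ε : ℝ}
    (hε : 0 < ε) (hετ : ε < τ) (hεy : ε < ⟪e, y⟫) :
    ∃ r : ℝ, 0 < r ∧ ε • e + r • (ε • e - y) ∈ frontier K ∧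
      ε • e + r • (ε • e - y) ∉ Submodule.span ℝ {e} ∧ 0 < ⟪e, ε • e + r • (ε • e - y)⟫ ∧
      ⟪e, ε • e + r • (ε • e - y)⟫ < ε := by
  have hmem (s : ℝ) : s • e ∈ Submodule.span ℝ {e} :=
    Submodule.smul_mem _ _ (Submodule.mem_span_singleton_self e)
  obtain ⟨r, hr, hb⟩ := exists_pos_add_smul_mem_frontier (d := ε • e - y) h.isCompact.isBounded
    (h.smul_mem_interior ε hε hετ) (by
      intro h0
      rw [sub_eq_zero] at h0
      exact hy (h0 ▸ hmem ε))
  have hbs : ε • e + r • (ε • e - y) ∉ Submodule.span ℝ {e} := by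
    intro hb
    apply hy
    have : y = r⁻¹ • (((1 + r) * ε) • e - (ε • e + r • (ε • e - y))) := by
      match_scalars <;> field_simp
      ring
    rw [this]
    exact Submodule.smul_mem _ _ (Submodule.sub_mem _ (hmem _) hb)
  refine ⟨r, hr, hb, hbs, h.inner_pos _ (h.isCompact.isClosed.frontier_subset hb) ?_, ?_⟩
  · intro h0
    rw [h0] at hbs
    exact hbs (Submodule.zero_mem _)
  · rw [inner_add_right, real_inner_smul_right, real_inner_smul_right, inner_sub_right,
      real_inner_smul_right, h.inner_self]
    nlinarith

theorem norm_sq_mul_eq_of_opposite (h : IsAxialBody K e τ) (hsym : HasAntiparallelSections K e)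
    {y b : V} (hy : y ∈ frontier K) (hb : b ∈ frontier K) (hys : y ∉ Submodule.span ℝ {e})
    (hne : ⟪e, y⟫ ≠ ⟪e, b⟫) {α β κ : ℝ} (hα : 0 < α) (hβ : 0 < β) (hκ : 0 < κ)
    (hκτ : κ < (α + β) * τ) (hyb : α • y + β • b = κ • e) :
    ‖y‖ ^ 2 * ⟪e, b⟫ = ‖b‖ ^ 2 * ⟪e, y⟫ := by
  have hαβ : 0 < α + β := by positivity
  refine hsym.chord h.convex h.isCompact.isClosed hy hb (s := β / (α + β)) (by positivity)
    (by rw [div_lt_one hαβ]; linarith) ?_ (c₁ := α / κ) (c₂ := β / κ) ?_ h.ne_zero hys hne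
  · have : y + (β / (α + β)) • (b - y) = (κ / (α + β)) • e := by
      rw [div_eq_inv_mul κ, mul_smul, ← hyb]
      match_scalars <;> field_simp
      ring
    rw [this]
    exact h.smul_mem_interior _ (by positivity) (by rw [div_lt_iff₀ hαβ]; linarith)
  · rw [div_eq_inv_mul, div_eq_inv_mul, mul_smul, mul_smul, ← smul_add, hyb, smul_smul,
      inv_mul_cancel₀ hκ.ne', one_smul]

/-- Apply the chord identity to `y` and `τ • e`. If that chord misses the interior, it is a segment
in the boundary, and chords across the axis would put it on a sphere. -/
theorem norm_sq_eq_of_inner_ne (h : IsAxialBody K e τ) (hsym : HasAntiparallelSections K e)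
    {y : V} (hy : y ∈ frontier K) (hys : y ∉ Submodule.span ℝ {e}) (hne : ⟪e, y⟫ ≠ τ) :
    ‖y‖ ^ 2 = τ * ⟪e, y⟫ := by
  have hτ := h.pos
  have hyK := h.isCompact.isClosed.frontier_subset hy
  have hTK := h.isCompact.isClosed.frontier_subset h.smul_mem_frontier
  have heT : ⟪e, τ • e⟫ = τ := by rw [real_inner_smul_right, h.inner_self, mul_one]
  have hy0 : y ≠ 0 := by rintro rfl; simp at hys
  have hypos := h.inner_pos y hyK hy0
  by_cases hint : ∃ s : ℝ, 0 < s ∧ s < 1 ∧ y + s • (τ • e - y) ∈ interior K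
  · obtain ⟨s, hs0, hs1, hs⟩ := hint
    have key := hsym.chord h.convex h.isCompact.isClosed hy h.smul_mem_frontier hs0 hs1 hs
      (c₁ := 0) (c₂ := τ⁻¹) (by
        rw [zero_smul, zero_add, smul_smul, inv_mul_cancel₀ hτ.ne', one_smul]) h.ne_zero hys
      (by rwa [heT])
    rw [heT, norm_smul, h.norm_eq_one, Real.norm_of_nonneg hτ.le] at key
    exact mul_right_cancel₀ hτ.ne' (by linear_combination key)
  · exfalso
    push Not at hint
    obtain ⟨ε, hε, hετ, hεy⟩ : ∃ ε : ℝ, 0 < ε ∧ ε < τ ∧ ε < ⟪e, y⟫ :=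
      ⟨min τ ⟪e, y⟫ / 2, by positivity, by linarith [min_le_left τ ⟪e, y⟫],
        by linarith [min_le_right τ ⟪e, y⟫]⟩
    obtain ⟨r, hr, hb, -, hb0, hbε⟩ := h.exists_opposite hys hε hετ hεy
    set b := ε • e + r • (ε • e - y) with hbdef
    have hw : ∀ s : ℝ, 0 < s → s < 1 →
        ‖τ • e + s • (y - τ • e)‖ ^ 2 * ⟪e, b⟫ = ‖b‖ ^ 2 * ⟪e, τ • e + s • (y - τ • e)⟫ := by
      intro s hs hs1
      have hz : ⟪e, τ • e + s • (y - τ • e)⟫ = (1 - s) * τ + s * ⟪e, y⟫ := by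
        rw [inner_add_right, real_inner_smul_right, real_inner_smul_right, inner_sub_right,
          real_inner_smul_right, h.inner_self]
        ring
      refine h.norm_sq_mul_eq_of_opposite hsym ⟨subset_closure ?_, ?_⟩ hb ?_ ?_ hr hs
        -- With weights `r` and `s` the multiples of `y` cancel in the combination with `b`.
        (κ := r * (1 - s) * τ + s * (1 + r) * ε) ?_ ?_ ?_
      · exact h.convex hTK hyK (sub_nonneg.2 hs1.le) hs.le (by ring) |> fun h => by
          convert h using 1; module
      · have := hint (1 - s) (by linarith) (by linarith)
        convert this using 2; module
      · intro hm
        apply hys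
        have : y = s⁻¹ • (((s - 1) * τ) • e + (τ • e + s • (y - τ • e))) := by
          match_scalars <;> field_simp
          ring
        rw [this]
        exact Submodule.smul_mem _ _ (Submodule.add_mem _ (Submodule.smul_mem _ _
          (Submodule.mem_span_singleton_self e)) hm)
      · rw [hz]
        nlinarith
      · have : 0 < 1 - s := by linarith
        positivity
      · nlinarith [mul_pos hs (mul_pos (by linarith : 0 < 1 + r) (sub_pos.2 hετ))]
      · rw [hbdef]; module
    have hnorm : ∀ s : ℝ, ‖τ • e + s • (y - τ • e)‖ ^ 2 =
        ‖τ • e‖ ^ 2 + 2 * s * ⟪τ • e, y - τ • e⟫ + s ^ 2 * ‖y - τ • e‖ ^ 2 := by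
      intro s
      rw [norm_add_sq_real, real_inner_smul_right, norm_smul s, mul_pow,
        Real.norm_eq_abs, sq_abs]
      ring
    have hlin : ∀ s : ℝ, ⟪e, τ • e + s • (y - τ • e)⟫ = τ + s * ⟪e, y - τ • e⟫ := by
      intro s
      rw [inner_add_right, heT, real_inner_smul_right]
    have h1 := hw (1 / 4) (by norm_num) (by norm_num)
    have h2 := hw (1 / 2) (by norm_num) (by norm_num)
    have h3 := hw (3 / 4) (by norm_num) (by norm_num)
    rw [hnorm, hlin] at h1 h2 h3
    -- A second difference in `s` isolates the quadratic coefficient; the other side is affine in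
    -- `s`.
    have h4 : ‖y - τ • e‖ ^ 2 * ⟪e, b⟫ = 0 := by
      linear_combination 8 * h1 - 16 * h2 + 8 * h3
    have h5 : y = τ • e := by
      have := (mul_eq_zero.1 h4).resolve_right hb0.ne'
      rwa [sq_eq_zero_iff, norm_eq_zero, sub_eq_zero] at this
    rw [h5, heT] at hne
    exact hne rfl

/-- Points at height `τ` escape the previous lemma, but their opposite points are lower than `τ`,
and the chord across the axis carries the value back. -/
theorem norm_sq_eq (h : IsAxialBody K e τ) (hsym : HasAntiparallelSections K e)
    {y : V} (hy : y ∈ frontier K) : ‖y‖ ^ 2 = τ * ⟪e, y⟫ := by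
  have hτ := h.pos
  have hyK := h.isCompact.isClosed.frontier_subset hy
  by_cases hy0 : y = 0
  · simp [hy0]
  have hypos := h.inner_pos y hyK hy0
  by_cases hys : y ∈ Submodule.span ℝ {e}
  · obtain ⟨s, rfl⟩ := Submodule.mem_span_singleton.1 hys
    rw [real_inner_smul_right, h.inner_self, mul_one] at *
    have hs : s = τ := by
      rcases lt_trichotomy s τ with hs | hs | hs
      · exact absurd (h.smul_mem_interior s hypos hs) hy.2
      · exact hs
      · refine absurd ?_ h.smul_mem_frontier.2
        refine h.convex.openSegment_interior_self_subset_interior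
          (h.smul_mem_interior (τ / 2) (by linarith) (by linarith)) hyK
          ⟨(s - τ) / (s - τ / 2), (τ / 2) / (s - τ / 2), ?_, ?_, ?_, ?_⟩
        · exact div_pos (by linarith) (by linarith)
        · exact div_pos (by linarith) (by linarith)
        · have : s - τ / 2 ≠ 0 := by linarith
          rw [← add_div, div_eq_one_iff_eq this]; ring
        · have : s - τ / 2 ≠ 0 := by linarith
          rw [smul_smul, smul_smul, ← add_smul]
          congr 1
          rw [div_mul_eq_mul_div, div_mul_eq_mul_div, ← add_div, div_eq_iff this]; ring
    rw [hs, norm_smul, h.norm_eq_one, Real.norm_of_nonneg hτ.le]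
    ring
  · obtain ⟨ε, hε, hετ, hεy⟩ : ∃ ε : ℝ, 0 < ε ∧ ε < τ ∧ ε < ⟪e, y⟫ :=
      ⟨min τ ⟪e, y⟫ / 2, by positivity, by linarith [min_le_left τ ⟪e, y⟫],
        by linarith [min_le_right τ ⟪e, y⟫]⟩
    obtain ⟨r, hr, hb, hbs, hb0, hbε⟩ := h.exists_opposite hys hε hετ hεy
    have h1 := h.norm_sq_eq_of_inner_ne hsym hb hbs (by linarith)
    have h2 := h.norm_sq_mul_eq_of_opposite hsym hy hb hys (by linarith) hr one_pos
      (κ := (1 + r) * ε) (by positivity) (by nlinarith) (by module)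
    rw [h1] at h2
    exact mul_right_cancel₀ hb0.ne' (by linear_combination h2)

theorem eq_closedBall (h : IsAxialBody K e τ) (hsym : HasAntiparallelSections K e) :
    K = Metric.closedBall ((τ / 2) • e) (τ / 2) := by
  have hτ := h.pos
  refine eq_closedBall_of_frontier_subset_sphere h.isCompact
    (h.smul_mem_interior _ (by linarith) (by linarith)) (by linarith) fun y hy => ?_
  rw [mem_sphere_iff_norm, ← pow_left_inj₀ (norm_nonneg _) (by linarith) two_ne_zero,
    norm_sub_sq_real, h.norm_sq_eq hsym hy, norm_smul, h.norm_eq_one,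
    Real.norm_of_nonneg (by linarith), real_inner_smul_right, real_inner_comm]
  ring

end IsAxialBody

end AntiparallelSections

/-! ### From stereographic images to antiparallel sections -/

section Extraction

variable {V : Type*} [NormedAddCommGroup V] [InnerProductSpace ℝ V]

theorem exists_eq_smul_of_forall_inner_eq_zero {a b : V} (ha : a ≠ 0)
    (h : ∀ w : V, ⟪a, w⟫ = 0 → ⟪b, w⟫ = 0) : ∃ l : ℝ, b = l • a := by
  have haa : ⟪a, a⟫ ≠ 0 := inner_self_ne_zero.2 ha
  refine ⟨⟪a, b⟫ / ⟪a, a⟫, ?_⟩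
  have h1 : ⟪a, b - (⟪a, b⟫ / ⟪a, a⟫) • a⟫ = 0 := by
    rw [inner_sub_right, real_inner_smul_right, div_mul_cancel₀ _ haa, sub_self]
  have h2 : ⟪b - (⟪a, b⟫ / ⟪a, a⟫) • a, b - (⟪a, b⟫ / ⟪a, a⟫) • a⟫ = 0 := by
    rw [inner_sub_left, real_inner_smul_left, h1, h _ h1, mul_zero, sub_zero]
  exact sub_eq_zero.1 (inner_self_eq_zero.1 h2)

theorem mem_span_singleton_of_forall_inner_eq_zero {a e : V} (ha : a ≠ 0) (he : e ≠ 0)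
    (h : ∀ w : V, ⟪a, w⟫ = 0 → ⟪e, w⟫ = 0) : a ∈ Submodule.span ℝ {e} := by
  obtain ⟨l, hl⟩ := exists_eq_smul_of_forall_inner_eq_zero ha h
  have hl0 : l ≠ 0 := by rintro rfl; rw [zero_smul] at hl; exact he hl
  rw [Submodule.mem_span_singleton]
  exact ⟨l⁻¹, by rw [hl, smul_smul, inv_mul_cancel₀ hl0, one_smul]⟩

theorem IsHalfTurn.apply_apply {R : E3 ≃ᵃⁱ[ℝ] E3} (hR : IsHalfTurn R) (x : E3) : R (R x) = x := by
  obtain ⟨L, hL, -, rfl⟩ := hR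
  exact EuclideanGeometry.reflection_reflection L x

theorem IsHalfTurn.exists_halfTurn {R : E3 ≃ᵃⁱ[ℝ] E3} (hR : IsHalfTurn R) {N : E3}
    (hN : R N = N) : ∃ u : E3, ‖u‖ = 1 ∧ ∀ x, R (N + x) = N + halfTurn u x := by
  obtain ⟨L, hL, hline, rfl⟩ := hR
  rw [EuclideanGeometry.reflection_eq_self_iff] at hN
  obtain ⟨v, hv0, hv⟩ := finrank_eq_one_iff'.1 hline
  have hv0' : (v : E3) ≠ 0 := by simpa using hv0
  have hu : ‖(‖(v : E3)‖⁻¹ • (v : E3))‖ = 1 := norm_smul_inv_norm (𝕜 := ℝ) hv0'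
  set u : E3 := ‖(v : E3)‖⁻¹ • (v : E3) with hudef
  refine ⟨u, hu, fun x => ?_⟩
  rw [EuclideanGeometry.reflection_apply_of_mem L _ hN, Submodule.reflection_apply,
    vsub_eq_sub, add_sub_cancel_left, vadd_eq_add, add_comm, halfTurn_apply]
  have huu : ⟪u, u⟫ = 1 := by rw [real_inner_self_eq_norm_sq, hu]; norm_num
  have hproj : L.direction.starProjection x = ⟪u, x⟫ • u := by
    refine Submodule.eq_starProjection_of_mem_of_inner_eq_zero
      (Submodule.smul_mem _ _ (Submodule.smul_mem _ _ v.2)) fun w hw => ?_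
    obtain ⟨l, hl⟩ := hv ⟨w, hw⟩
    have hw' : w = (l * ‖(v : E3)‖) • u := by
      rw [hudef, smul_smul, mul_assoc, mul_inv_cancel₀ (norm_ne_zero_iff.2 hv0'), mul_one]
      exact (congrArg Subtype.val hl).symm
    rw [hw', real_inner_smul_right, inner_sub_left, real_inner_smul_left, huu,
      real_inner_comm u x]
    ring
  rw [hproj]
  module

/-- An isometric involution preserving the boundary of a pointed cone fixes its apex. -/
theorem apply_apex_eq_of_image_frontier {R : E3 ≃ᵃⁱ[ℝ] E3} (hinv : ∀ x, R (R x) = x)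
    {C : Set E3} {N e : E3} (hdouble : ∀ x, AffineMap.lineMap N x (2 : ℝ) ∈ C ↔ x ∈ C)
    (hR : R '' frontier C = frontier C) (hN : N ∈ frontier C) {c : ℝ} (hc : 0 < c)
    (hpt : ∀ x ∈ closure C, c * ‖x - N‖ ≤ ⟪e, x - N⟫) : R N = N := by
  have hmaps : ∀ x ∈ frontier C, R x ∈ frontier C := fun x hx => hR ▸ Set.mem_image_of_mem R hx
  have hcont : Continuous fun x : E3 => AffineMap.lineMap N x (2 : ℝ) := by
    simp only [AffineMap.lineMap_apply, vsub_eq_sub, vadd_eq_add]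
    fun_prop
  have hv := hmaps N hN
  have h2v : AffineMap.lineMap N (R N) (2 : ℝ) ∈ frontier C := by
    rw [frontier_eq_closure_inter_closure] at hv ⊢
    exact ⟨map_mem_closure (f := fun x => AffineMap.lineMap N x (2 : ℝ)) hcont hv.1
        fun x hx => (hdouble x).2 hx,
      map_mem_closure (f := fun x => AffineMap.lineMap N x (2 : ℝ)) hcont hv.2
        fun x hx h => hx ((hdouble x).1 h)⟩
  have h3 := hmaps _ h2v
  have h4 : R (AffineMap.lineMap N (R N) (2 : ℝ)) = AffineMap.lineMap (R N) N (2 : ℝ) := by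
    have := R.toAffineEquiv.toAffineMap.apply_lineMap N (R N) (2 : ℝ)
    rw [AffineEquiv.coe_toAffineMap, AffineIsometryEquiv.coe_toAffineEquiv, hinv] at this
    exact this
  rw [h4] at h3
  have i1 := hpt _ hv.1
  have i2 := hpt _ h3.1
  have h5 : AffineMap.lineMap (R N) N (2 : ℝ) - N = -(R N - N) := by
    rw [AffineMap.lineMap_apply, vsub_eq_sub, vadd_eq_add]; module
  rw [h5, norm_neg, inner_neg_right] at i2
  have h6 : ‖R N - N‖ ≤ 0 := by nlinarith
  exact sub_eq_zero.1 (norm_le_zero_iff.1 h6)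

/-- The hypothesis on stereographic images of plane sections, seen from `N` as the origin. -/
theorem hasAntiparallelSections_of_stereographic {K : Set E3} (hK : Convex ℝ K)
    (hKc : IsCompact K) {N : E3} {P : AffineSubspace ℝ E3} {e : E3} (he : ‖e‖ = 1) {η : ℝ}
    (hη : 0 < η) (hP : ∀ y, y ∈ P ↔ ⟪e, y - N⟫ = η)
    (hpos : ∀ x : E3, N + x ∈ K → x ≠ 0 → 0 < ⟪e, x⟫)
    (h : ∀ Γ : AffineSubspace ℝ E3, IsPlane Γ → ((Γ : Set E3) ∩ interior K).Nonempty →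
      N ∉ Γ → ¬ Γ.Parallel P →
      ∃ R : E3 ≃ᵃⁱ[ℝ] E3, IsHalfTurn R ∧
        R '' boundaryCone N ((Γ : Set E3) ∩ K) = boundaryCone N ((Γ : Set E3) ∩ K) ∧
        ∃ k : ℝ, k ≠ 0 ∧
          stereographicImage N P ((Γ : Set E3) ∩ K) =
            R '' (AffineMap.homothety N k '' ((Γ : Set E3) ∩ K))) :
    HasAntiparallelSections ((fun x => N + x) ⁻¹' K) e := by
  set K₀ : Set E3 := (fun x => N + x) ⁻¹' K with hK₀
  have hK₀conv : Convex ℝ K₀ := hK.translate_preimage_right N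
  have hK₀c : IsCompact K₀ := (Homeomorph.addLeft N).isCompact_preimage.2 hKc
  have hint : interior K₀ = (fun x => N + x) ⁻¹' interior K :=
    ((Homeomorph.addLeft N).preimage_interior K).symm
  intro a p hp hap hae
  have he0 : e ≠ 0 := by rintro rfl; simp at he
  have ha0 : a ≠ 0 := by rintro rfl; simp at hap
  have hpK := interior_subset hp
  obtain ⟨w, haw, hw0⟩ : ∃ w : E3, ⟪a, w⟫ = 0 ∧ w ≠ 0 := by
    by_contra! hall
    exact hae (mem_span_singleton_of_forall_inner_eq_zero ha0 he0 fun w hw => by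
      rw [hall w hw, inner_zero_right])
  let Γ : AffineSubspace ℝ E3 := AffineSubspace.mk' (N + p) (Submodule.span ℝ {a})ᗮ
  have hΓ : ∀ y, y ∈ Γ ↔ ⟪a, y - N⟫ = 1 := by
    intro y
    rw [AffineSubspace.mem_mk', Submodule.mem_orthogonal_singleton_iff_inner_right, vsub_eq_sub,
      ← sub_sub, inner_sub_right, hap, sub_eq_zero]
  have hΓplane : IsPlane Γ := by
    have : Fact (Module.finrank ℝ E3 = 2 + 1) := ⟨by simp⟩
    rw [IsPlane, AffineSubspace.direction_mk']
    exact Submodule.finrank_orthogonal_span_singleton ha0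
  have hΓpar : ¬ Γ.Parallel P := by
    intro hpar
    apply hae
    refine mem_span_singleton_of_forall_inner_eq_zero ha0 he0 fun v hv => ?_
    have hvP : v ∈ P.direction := by
      rw [← hpar.direction_eq, AffineSubspace.direction_mk',
        Submodule.mem_orthogonal_singleton_iff_inner_right]
      exact hv
    have hee : ⟪e, e⟫ = 1 := by rw [real_inner_self_eq_norm_sq, he]; norm_num
    have hq : N + η • e ∈ P := by
      rw [hP, add_sub_cancel_left, real_inner_smul_right, hee, mul_one]
    have := AffineSubspace.vadd_mem_of_mem_direction hvP hq
    rw [hP, vadd_eq_add, add_sub_assoc, add_sub_cancel_left, inner_add_right,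
      real_inner_smul_right, hee] at this
    linarith
  obtain ⟨R, hRhalf, hRcone, k, hk, hRk⟩ := h Γ hΓplane
    ⟨N + p, (hΓ _).2 (by simpa using hap), by rw [hint] at hp; exact hp⟩
    (by rw [hΓ]; simp) hΓpar
  set C := solidCone N ((Γ : Set E3) ∩ K) with hCdef
  have hC : ∀ x, N + x ∈ C ↔ ∃ y ∈ K₀, ⟪a, y⟫ = 1 ∧ ∃ t : ℝ, 0 ≤ t ∧ x = t • y := by
    intro x
    constructor
    · rintro ⟨y, ⟨hy1, hy2⟩, t, ht, hx⟩
      exact ⟨y - N, by simpa [hK₀] using hy2, (hΓ y).1 hy1, t, ht, add_left_cancel hx⟩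
    · rintro ⟨y, hy, hay, t, ht, rfl⟩
      exact ⟨N + y, ⟨(hΓ _).2 (by simpa using hay), hy⟩, t, ht, by simp⟩
  -- Pointedness: on the compact section `⟪e, y⟫` has a positive minimum and `‖y‖` is bounded.
  obtain ⟨c, hc, hpt⟩ : ∃ c : ℝ, 0 < c ∧ ∀ x ∈ closure C, c * ‖x - N‖ ≤ ⟪e, x - N⟫ := by
    have hW : IsCompact (K₀ ∩ {y | ⟪a, y⟫ = 1}) :=
      hK₀c.inter_right (isClosed_eq (by fun_prop) continuous_const)
    obtain ⟨y₀, hy₀, hmin⟩ := hW.exists_isMinOn ⟨p, hpK, hap⟩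
      (f := fun y => ⟪e, y⟫) (by fun_prop)
    obtain ⟨M, hM⟩ := hW.isBounded.exists_norm_le
    have hM0 : 0 ≤ M := (norm_nonneg _).trans (hM y₀ hy₀)
    have hy₀pos : 0 < ⟪e, y₀⟫ := hpos y₀ hy₀.1 (by
      rintro rfl
      have := hy₀.2
      simp at this)
    refine ⟨⟪e, y₀⟫ / (M + 1), by positivity, fun x hx => ?_⟩
    refine closure_minimal (t := {x : E3 | ⟪e, y₀⟫ / (M + 1) * ‖x - N‖ ≤ ⟪e, x - N⟫}) ?_
      (isClosed_le (by fun_prop) (by fun_prop)) hx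
    intro x hx
    obtain ⟨y, hy, hay, t, ht, hxy⟩ := (hC (x - N)).1 (by simpa using hx)
    rw [Set.mem_ofPred_eq, hxy, norm_smul, real_inner_smul_right, Real.norm_of_nonneg ht]
    have h1 := hM y ⟨hy, hay⟩
    have h2 : ⟪e, y₀⟫ ≤ ⟪e, y⟫ := hmin ⟨hy, hay⟩
    have h3 : ⟪e, y₀⟫ / (M + 1) * ‖y‖ ≤ ⟪e, y₀⟫ := by
      rw [div_mul_eq_mul_div, div_le_iff₀ (by positivity)]
      nlinarith
    nlinarith
  have hN : N ∈ frontier C := by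
    refine ⟨subset_closure ?_, fun hi => ?_⟩
    · have := (hC 0).2 ⟨p, hpK, hap, 0, le_rfl, by simp⟩
      simpa using this
    · obtain ⟨ε, hε, hball⟩ := Metric.mem_nhds_iff.1 (mem_interior_iff_mem_nhds.1 hi)
      have h1 : N + (-(ε / 2)) • e ∈ C := hball (by
        rw [mem_ball_iff_norm, add_sub_cancel_left, norm_smul, he, norm_neg,
          Real.norm_of_nonneg (by positivity)]
        linarith)
      have h2 := hpt _ (subset_closure h1)
      rw [add_sub_cancel_left, norm_smul, real_inner_smul_right, he, norm_neg,
        Real.norm_of_nonneg (by positivity), real_inner_self_eq_norm_sq, he] at h2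
      nlinarith
  have hdouble : ∀ x, AffineMap.lineMap N x (2 : ℝ) ∈ C ↔ x ∈ C := by
    intro x
    have hx : x = N + (x - N) := by abel
    rw [AffineMap.lineMap_apply, vsub_eq_sub, vadd_eq_add, add_comm _ N, hC]
    nth_rw 2 [hx]
    rw [hC]
    constructor
    · rintro ⟨y, hy, hay, t, ht, hxt⟩
      refine ⟨y, hy, hay, t / 2, by positivity, ?_⟩
      rw [div_eq_inv_mul, mul_smul, ← hxt]
      module
    · rintro ⟨y, hy, hay, t, ht, hxt⟩
      exact ⟨y, hy, hay, 2 * t, by positivity, by rw [hxt, smul_smul]⟩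
  have hRN := apply_apex_eq_of_image_frontier hRhalf.apply_apply hdouble hRcone hN hc hpt
  obtain ⟨u, hu, hRu⟩ := hRhalf.exists_halfTurn hRN
  obtain ⟨r, hr, hy₁⟩ := exists_pos_add_smul_mem_frontier hK₀c.isBounded hp hw0
  set y₁ := p + r • w with hy₁def
  have hay₁ : ⟪a, y₁⟫ = 1 := by
    rw [hy₁def, inner_add_right, real_inner_smul_right, hap, haw]; simp
  have hy₁K : y₁ ∈ K₀ := hK₀c.isClosed.frontier_subset hy₁
  have hy₁0 : y₁ ≠ 0 := by rintro h0; simp [h0] at hay₁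
  have hy₁C : N + y₁ ∈ frontier C := by
    -- Were `N + y₁` interior to the cone, a small move along `w` would stay in the section plane
    -- and give a point of `K₀` beyond `y₁`.
    refine ⟨subset_closure ((hC _).2 ⟨y₁, hy₁K, hay₁, 1, zero_le_one, by simp⟩), fun hi => ?_⟩
    obtain ⟨ε, hε, hball⟩ := Metric.mem_nhds_iff.1 (mem_interior_iff_mem_nhds.1 hi)
    have hw0' : 0 < ‖w‖ := norm_pos_iff.2 hw0
    have h1 : N + (y₁ + (ε / 2 / ‖w‖) • w) ∈ C := hball (by
      rw [mem_ball_iff_norm, ← add_assoc, add_sub_cancel_left, norm_smul,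
        Real.norm_of_nonneg (by positivity), div_mul_cancel₀ _ hw0'.ne']
      linarith)
    obtain ⟨y, hy, hay, t, ht, hty⟩ := (hC _).1 h1
    have ht1 : t = 1 := by
      have := congrArg (fun z => ⟪a, z⟫) hty
      simp only [inner_add_right, real_inner_smul_right, hay, haw, hay₁] at this
      linarith
    rw [ht1, one_smul] at hty
    refine absurd (hK₀conv.le_one_of_mem_of_frontier (x := p) (y := y₁) (s := 0)
      (μ := 1 + ε / 2 / ‖w‖ / r) hy₁ one_pos (by simpa using hp) ?_) (not_le.2 ?_)
    · rw [← hty] at hy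
      convert hy using 1
      rw [hy₁def]
      match_scalars <;> field_simp
      ring
    · have : 0 < ε / 2 / ‖w‖ / r := by positivity
      linarith
  have himage : ∀ y ∈ K₀, ⟪a, y⟫ = 1 → k * ⟪e, halfTurn u y⟫ = η ∧
      ∃ s : ℝ, 0 < s ∧ ∃ q ∈ K₀, ⟪a, q⟫ = 1 ∧ k • halfTurn u y = s • q := by
    intro y hy hay
    have hmem : N + k • halfTurn u y ∈ stereographicImage N P ((Γ : Set E3) ∩ K) := by
      rw [hRk]
      refine ⟨_, ⟨N + y, ⟨(hΓ _).2 (by simpa using hay), hy⟩, rfl⟩, ?_⟩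
      rw [AffineMap.homothety_apply, vsub_eq_sub, vadd_eq_add, add_sub_cancel_left, add_comm _ N,
        hRu, map_smul]
    obtain ⟨x, ⟨hxΓ, hxK⟩, hxN, hline, hxP⟩ := hmem
    obtain ⟨s, hs⟩ := mem_affineSpan_pair_iff_exists_lineMap_eq.1 hline
    rw [AffineMap.lineMap_apply, vsub_eq_sub, vadd_eq_add, add_comm _ N] at hs
    have hs' := add_left_cancel hs
    rw [hP, add_sub_cancel_left] at hxP
    have hxK₀ : x - N ∈ K₀ := by simpa [hK₀] using hxK
    have hxpos := hpos (x - N) (by simpa using hxK) (sub_ne_zero.2 hxN)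
    refine ⟨by rw [← hxP, real_inner_smul_right], s, ?_, x - N, hxK₀, (hΓ x).1 hxΓ, hs'.symm⟩
    rw [← hs', real_inner_smul_right] at hxP
    exact pos_of_mul_pos_left (hxP ▸ hη) hxpos.le
  -- The cone condition fixes the sign: `R` keeps a boundary ray in the closed cone, where `⟪e, ·⟫`
  -- is positive off the apex.
  have hkpos : 0 < k := by
    have h1 : R (N + y₁) ∈ frontier C := by
      have h2 : R '' frontier C = frontier C := hRcone
      rw [← h2]
      exact Set.mem_image_of_mem R hy₁C
    have h2 := hpt _ h1.1
    rw [hRu, add_sub_cancel_left, norm_halfTurn hu] at h2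
    have h3 : 0 < ⟪e, halfTurn u y₁⟫ :=
      lt_of_lt_of_le (mul_pos hc (norm_pos_iff.2 hy₁0)) h2
    exact pos_of_mul_pos_left ((himage y₁ hy₁K hay₁).1 ▸ hη) h3.le
  -- `⟪halfTurn u e, ·⟫` is constant on the section, so it vanishes on the plane's directions.
  obtain ⟨l, hl⟩ : ∃ l : ℝ, halfTurn u e = l • a := by
    refine exists_eq_smul_of_forall_inner_eq_zero ha0 fun v hv => ?_
    by_cases hv0 : v = 0
    · rw [hv0, inner_zero_right]
    obtain ⟨δ, hδ, hδf⟩ := exists_pos_add_smul_mem_frontier hK₀c.isBounded hp hv0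
    have h1 := (himage p hpK hap).1
    have h2 := (himage (p + δ • v) (hK₀c.isClosed.frontier_subset hδf) (by
      rw [inner_add_right, real_inner_smul_right, hap, hv]; simp)).1
    rw [← inner_halfTurn_left] at h1 h2
    rw [inner_add_right, real_inner_smul_right] at h2
    have h3 : k * δ * ⟪halfTurn u e, v⟫ = 0 := by linear_combination h2 - h1
    exact (mul_eq_zero.1 h3).resolve_left (by positivity)
  refine ⟨u, hu, l, ?_, hl, fun y hy hay => ?_⟩
  · have h1 := (himage p hpK hap).1
    rw [← inner_halfTurn_left, hl, real_inner_smul_left, hap, mul_one] at h1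
    exact pos_of_mul_pos_right (h1 ▸ hη) hkpos.le
  · obtain ⟨-, s, hs, q, hq, haq, hsq⟩ := himage y hy hay
    refine ⟨s / k, by positivity, q, hq, haq, ?_⟩
    rw [div_eq_inv_mul, mul_smul, ← hsq, smul_smul, inv_mul_cancel₀ hk, one_smul]

/-- If every line through `0 ∈ frontier K` and another frontier point is transversal to `eᗮ`,
and some point of `K` lies on the positive side of `eᗮ`, then so does all of `K` but `0`. -/
theorem inner_pos_of_forall_frontier_ne_zero {K : Set V} (hK : Convex ℝ K) (hKc : IsCompact K)
    (hint : (interior K).Nonempty) (h0 : 0 ∈ frontier K) {e S : V}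
    (hne : ∀ x ∈ frontier K, x ≠ 0 → ⟪e, x⟫ ≠ 0) (hS : S ∈ K) (hSpos : 0 < ⟪e, S⟫)
    {x : V} (hx : x ∈ K) (hx0 : x ≠ 0) : 0 < ⟪e, x⟫ := by
  have hne' : ∀ x ∈ K, x ≠ 0 → ⟪e, x⟫ ≠ 0 := by
    intro x hx hx0
    obtain ⟨r, hr, hf⟩ := exists_nonneg_add_smul_mem_frontier hKc.isBounded hx hx0
    have hr1 : 1 + r ≠ 0 := by positivity
    rw [show x + r • x = (1 + r) • x by module] at hf
    have := hne _ hf (smul_ne_zero hr1 hx0)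
    rw [real_inner_smul_right] at this
    exact right_ne_zero_of_mul this
  have hopp : ∀ x ∈ K, ∀ p ∈ interior K, ¬ ⟪e, x⟫ * ⟪e, p⟫ < 0 := by
    intro x hx p hp hneg
    have hd : 0 < ⟪e, p⟫ ^ 2 - ⟪e, x⟫ * ⟪e, p⟫ := by nlinarith [sq_nonneg ⟪e, p⟫]
    have hp2 : 0 < ⟪e, p⟫ ^ 2 := by
      have : ⟪e, p⟫ ≠ 0 := right_ne_zero_of_mul hneg.ne
      positivity
    set d := ⟪e, p⟫ ^ 2 - ⟪e, x⟫ * ⟪e, p⟫ with hddef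
    -- The weights are chosen so that `⟪e, ·⟫` vanishes at this interior point.
    have hz : (⟪e, p⟫ ^ 2 / d) • x + (-(⟪e, x⟫ * ⟪e, p⟫) / d) • p ∈ interior K :=
      hK.openSegment_self_interior_subset_interior hx hp
        ⟨_, _, by positivity, div_pos (by linarith) hd, by
          rw [← add_div, div_eq_one_iff_eq hd.ne']; ring, rfl⟩
    refine hne' _ (interior_subset hz) ?_ ?_
    · intro hz0
      rw [hz0] at hz
      exact h0.2 hz
    · rw [inner_add_right, real_inner_smul_right, real_inner_smul_right]
      ring
  obtain ⟨p, hp⟩ := hint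
  have hp0 : p ≠ 0 := by rintro rfl; exact h0.2 hp
  have hppos : 0 < ⟪e, p⟫ := by
    by_contra! hle
    have hlt := lt_of_le_of_ne hle (hne' p (interior_subset hp) hp0)
    exact hopp S hS p hp (mul_neg_of_pos_of_neg hSpos hlt)
  by_contra! hle
  have hlt := lt_of_le_of_ne hle (hne' x hx hx0)
  exact hopp x hx p hp (mul_neg_of_neg_of_pos hlt hppos)

end Extraction

/-! ### Assembly with `N` as origin -/

theorem theorem4 (K : Set E3) (hK : IsConvexBody K) (N S : E3)
    (hN : N ∈ frontier K) (hS : S ∈ frontier K) (hNS : N ≠ S)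
    (P : AffineSubspace ℝ E3) (hP : IsSupportPlane K S P)
    (hPunique : ∀ Q : AffineSubspace ℝ E3, IsSupportPlane K S Q → Q = P)
    (hΨ : StereographicWellDefined K N P)
    (h : ∀ Γ : AffineSubspace ℝ E3, IsPlane Γ → ((Γ : Set E3) ∩ interior K).Nonempty →
      N ∉ Γ → ¬ Γ.Parallel P →
      ∃ R : E3 ≃ᵃⁱ[ℝ] E3, IsHalfTurn R ∧
        R '' boundaryCone N ((Γ : Set E3) ∩ K) = boundaryCone N ((Γ : Set E3) ∩ K) ∧
        ∃ k : ℝ, k ≠ 0 ∧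
          stereographicImage N P ((Γ : Set E3) ∩ K) =
            R '' (AffineMap.homothety N k '' ((Γ : Set E3) ∩ K))) :
    ∃ (c : E3) (r : ℝ), 0 < r ∧ K = Metric.closedBall c r := by
  obtain ⟨hSK, n, hn0, hPn, hsupp⟩ := hP
  have hn : 0 < ‖n‖ := norm_pos_iff.2 hn0
  have hNK := hK.isCompact.isClosed.frontier_subset hN
  have hSP : S ∈ P := (hPn S).2 rfl
  -- Otherwise the line through `N` and `S` would meet `P` in both points.
  have hNP : N ∉ P := by
    intro hNP
    obtain ⟨y, -, hy⟩ := hΨ S hS hNS.symm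
    exact hNS ((hy N ⟨left_mem_affineSpan_pair ℝ N S, hNP⟩).trans
      (hy S ⟨right_mem_affineSpan_pair ℝ N S, hSP⟩).symm)
  have hNlt : ⟪n, N⟫ < ⟪n, S⟫ := lt_of_le_of_ne (hsupp N hNK) fun hE => hNP ((hPn N).2 hE)
  set e : E3 := ‖n‖⁻¹ • n with hedef
  have he : ‖e‖ = 1 := norm_smul_inv_norm (𝕜 := ℝ) hn0
  have hη : 0 < ⟪e, S - N⟫ := by
    rw [hedef, real_inner_smul_left, inner_sub_right]
    exact mul_pos (by positivity) (by linarith)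
  have hPe : ∀ y, y ∈ P ↔ ⟪e, y - N⟫ = ⟪e, S - N⟫ := by
    intro y
    rw [hPn, hedef, real_inner_smul_left, real_inner_smul_left,
      mul_right_inj' (inv_ne_zero hn.ne'), inner_sub_right, inner_sub_right, sub_left_inj]
  set K₀ : Set E3 := (fun x => N + x) ⁻¹' K with hK₀
  have hK₀conv : Convex ℝ K₀ := hK.convex.translate_preimage_right N
  have hK₀c : IsCompact K₀ := (Homeomorph.addLeft N).isCompact_preimage.2 hK.isCompact
  have hint : interior K₀ = (fun x => N + x) ⁻¹' interior K :=
    ((Homeomorph.addLeft N).preimage_interior K).symm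
  have hfront : frontier K₀ = (fun x => N + x) ⁻¹' frontier K :=
    ((Homeomorph.addLeft N).preimage_frontier K).symm
  have h0 : (0 : E3) ∈ frontier K₀ := by rw [hfront]; simpa using hN
  have hintne : (interior K₀).Nonempty := by
    obtain ⟨q, hq⟩ := hK.interior_nonempty
    exact ⟨q - N, by rw [hint]; simpa using hq⟩
  have hpos : ∀ x ∈ K₀, x ≠ 0 → 0 < ⟪e, x⟫ := by
    intro x hx hx0
    refine inner_pos_of_forall_frontier_ne_zero hK₀conv hK₀c hintne h0 ?_ (S := S - N)
      (by simpa [hK₀] using hSK) hη hx hx0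
    intro x hx hx0 hex
    rw [hfront] at hx
    obtain ⟨y, ⟨hy, hyP⟩, -⟩ := hΨ (N + x) hx (by simpa using hx0)
    obtain ⟨s, rfl⟩ := mem_affineSpan_pair_iff_exists_lineMap_eq.1 hy
    rw [hPe, AffineMap.lineMap_apply, vsub_eq_sub, vadd_eq_add, add_sub_cancel_right,
      add_sub_cancel_left, real_inner_smul_right, hex, mul_zero] at hyP
    exact hη.ne hyP
  have hsym : HasAntiparallelSections K₀ e :=
    hasAntiparallelSections_of_stereographic hK.convex hK.isCompact he hη hPe hpos h
  obtain ⟨w, hw⟩ : ∃ w : E3, w ∉ Submodule.span ℝ {e} := by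
    by_contra! hall
    have h1 := finrank_span_singleton (K := ℝ) (v := e) (by rintro h0; simp [h0] at he)
    rw [(Submodule.eq_top_iff'.2 hall), finrank_top] at h1
    simp at h1
  obtain ⟨p, hp⟩ := hintne
  obtain ⟨t, ht, hte⟩ := hsym.exists_smul_mem_interior hK₀conv hK₀c.isClosed he hp
    (hpos p (interior_subset hp) (by rintro rfl; exact h0.2 hp)) hw
  obtain ⟨τ, hτ⟩ := exists_isAxialBody hK₀conv hK₀c he h0 hpos ht hte
  refine ⟨N + (τ / 2) • e, τ / 2, half_pos hτ.pos, ?_⟩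
  have hball := hτ.eq_closedBall hsym
  ext x
  have hx : x ∈ K ↔ x - N ∈ K₀ := by simp [hK₀]
  rw [hx, hball, mem_closedBall_iff_norm, mem_closedBall_iff_norm, sub_sub]
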